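/- Let $n\ge 1$ and let $\mathfrak S_n$ be the set of permutations of $\{1,\dots,n\}$. For $\sigma\in\mathfrak S_n$ put $\sigma(0)=\sigma(n+1)=0$, let $\operatorname{inv}\sigma$ be the number of pairs $1\le i<j\le n$ with $\sigma(i)>\sigma(j)$, let $\operatorname{exc}\sigma$ be the number of $i\in\{1,\dots,n\}$ with $i<\sigma(i)$, let $\operatorname{les}\sigma$ be the number of pairs $2\le i<j\le n$ with $\sigma(i-1)>\sigma(j)>\sigma(i)$, and let $\operatorname{res}\sigma$ be the number of pairs $1\le i<j\le n-1$ with $\sigma(j+1)>\sigma(i)>\sigma(j)$. For $1\le i\le n$, the value $\sigma(i)$ is a valley if $\sigma(i-1)>\sigma(i)<\sigma(i+1)$, and a double descent if $\sigma(i-1)>\sigma(i)>\sigma(i+1)$. Let $\mathfrak S_{n,k}$ be the set of $\sigma\in\mathfrak S_n$ with exactly $k$ valleys and without double descents, and let $$S_n(q,t)=\sum_{\sigma\in\mathfrak S_n}q^{\operatorname{inv}\sigma}t^{\operatorname{exc}\sigma},\qquad a_{n,k}(p,q)=\sum_{\sigma\in\mathfrak S_{n,k}}p^{\operatorname{res}\sigma}q^{\operatorname{les}\sigma}.$$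 Then there exist polynomials $\gamma_{n,k}(q)$, $0\le k\le (n-1)/2$, with nonnegative integer coefficients such that $$S_n(q,t/q)=\sum_{\sigma\in\mathfrak S_n}q^{\operatorname{inv}\sigma-\operatorname{exc}\sigma}t^{\operatorname{exc}\sigma}=\sum_{0\le k\le (n-1)/2}\gamma_{n,k}(q)\,t^k(1+t)^{n-1-2k}.$$ Moreover, for $0\le k\le (n-1)/2$, $$\gamma_{n,k}(q)=a_{n,k}(q^2,q)=\sum_{\sigma\in\mathfrak S_{n,k}}q^{2\operatorname{res}\sigma+\operatorname{les}\sigma},$$ and $\gamma_{n,k}(q)$ is divisible by $q^k(1+q)^k$ in $\mathbb Z[q]$. -/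

import Mathlib

open Polynomial
open scoped LaurentPolynomial

namespace InvExc

/-- The one-line notation of a permutation with 1-based indexing: `word σ i` is `σ(i) ∈ {1, …, n}`
for `1 ≤ i ≤ n`, with the convention `σ(0) = σ(n+1) = 0`. -/
def word {n : ℕ} (σ : Equiv.Perm (Fin n)) (i : ℕ) : ℕ :=
  if h : 1 ≤ i ∧ i ≤ n then (σ ⟨i - 1, by omega⟩ : ℕ) + 1 else 0

/-- Number of inversions: pairs `1 ≤ i < j ≤ n` with `σ(i) > σ(j)`. -/
def inv {n : ℕ} (σ : Equiv.Perm (Fin n)) : ℕ :=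
  ((Finset.Icc 1 n ×ˢ Finset.Icc 1 n).filter
    fun p : ℕ × ℕ => p.1 < p.2 ∧ word σ p.2 < word σ p.1).card

/-- Number of excedances: `1 ≤ i ≤ n` with `i < σ(i)`. -/
def exc {n : ℕ} (σ : Equiv.Perm (Fin n)) : ℕ :=
  ((Finset.Icc 1 n).filter fun i : ℕ => i < word σ i).card

/-- Number of pairs `2 ≤ i < j ≤ n` with `σ(i-1) > σ(j) > σ(i)`. -/
def les {n : ℕ} (σ : Equiv.Perm (Fin n)) : ℕ :=
  ((Finset.Icc 2 n ×ˢ Finset.Icc 2 n).filter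
    fun p : ℕ × ℕ => p.1 < p.2 ∧ word σ p.2 < word σ (p.1 - 1) ∧ word σ p.1 < word σ p.2).card

/-- Number of pairs `1 ≤ i < j ≤ n - 1` with `σ(j+1) > σ(i) > σ(j)`. -/
def res {n : ℕ} (σ : Equiv.Perm (Fin n)) : ℕ :=
  ((Finset.Icc 1 (n - 1) ×ˢ Finset.Icc 1 (n - 1)).filter
    fun p : ℕ × ℕ => p.1 < p.2 ∧ word σ p.1 < word σ (p.2 + 1) ∧ word σ p.2 < word σ p.1).card

/-- Number of valleys: `1 ≤ i ≤ n` with `σ(i-1) > σ(i) < σ(i+1)`. -/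
def valleys {n : ℕ} (σ : Equiv.Perm (Fin n)) : ℕ :=
  ((Finset.Icc 1 n).filter
    fun i : ℕ => word σ i < word σ (i - 1) ∧ word σ i < word σ (i + 1)).card

/-- Number of double descents: `1 ≤ i ≤ n` with `σ(i-1) > σ(i) > σ(i+1)`. -/
def doubleDescents {n : ℕ} (σ : Equiv.Perm (Fin n)) : ℕ :=
  ((Finset.Icc 1 n).filter
    fun i : ℕ => word σ i < word σ (i - 1) ∧ word σ (i + 1) < word σ i).card

/-- The set `S_{n,k}` of permutations with exactly `k` valleys and without double descents. -/
def permsWithValleys (n k : ℕ) : Finset (Equiv.Perm (Fin n)) :=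
  Finset.univ.filter fun σ => valleys σ = k ∧ doubleDescents σ = 0

/-- `S_n(q,t) = ∑_σ q^{inv σ} t^{exc σ}` in `ℤ[q][t]`. -/
noncomputable def S (n : ℕ) : ℤ[X][X] :=
  ∑ σ : Equiv.Perm (Fin n), C (X ^ inv σ) * X ^ exc σ

/-- `S_n(q,t/q)` in `ℤ[q,q⁻¹][t]`: the substitution `q ↦ q`, `t ↦ q⁻¹ t` in `S_n(q,t)`. -/
noncomputable def SDiv (n : ℕ) : ℤ[T;T⁻¹][X] :=
  (S n).eval₂ (C.comp (toLaurent : ℤ[X] →+* ℤ[T;T⁻¹])) (C (LaurentPolynomial.T (-1)) * X)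

/-- `a_{n,k}(p,q) = ∑_{σ ∈ S_{n,k}} p^{res σ} q^{les σ}`; the variables are `p = X 0`, `q = X 1`. -/
noncomputable def a (n k : ℕ) : MvPolynomial (Fin 2) ℤ :=
  ∑ σ ∈ permsWithValleys n k, MvPolynomial.X 0 ^ res σ * MvPolynomial.X 1 ^ les σ

end InvExc

/-!
Both sides of the expansion count weighted Motzkin paths. Put `w_h = q^{h-1} [h]_q`.

For `S_n(q, t/q)`, let `E_h(n)` and `O_h(n)` be the sums of `q^{inv - exc} t^{exc}` over the
permutations of size `n` whose matrix is zero in the upper left `h × h`, respectively `h × (h + 1)`,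
corner. The entry in the next column, then the entry in the next row, either avoids the corner or
can be deleted at the price of an explicit factor, which gives (`cornerSum_column`, `cornerSum_row`)

* `E_{h+1}(n+1) = O_{h+1}(n+1) + t w_{h+1} O_h(n)`,
* `O_h(n+1) = E_{h+1}(n+1) + w_{h+1} E_h(n)`.

Eliminating `E` shows that `O_0(n) = S_n(q, t/q)` is the sum `motzkin q t (1 + t) (n - 1) 0` over
Motzkin paths whose level steps at height `h` weigh `(1 + t) w_{h+1}` and whose falls from height `h`
weigh `t w_h w_{h+1}` (`cornerSum_add_one_eq_motzkin`).

For the permutations without double descents, the letters of the one-line notation are inserted in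
decreasing order: the smaller letters between two larger ones are contracted to a single `0`, and a
new letter replaces one such `0` by `0v0`, `0v`, `v0` or `v`, according as it is a peak, a double
ascent, a double descent or a valley. The contribution of `v` to `les` and `res` is the number of
gaps between zeros on its left and on its right, so that the sum over all places is a `q`-integer
(`sum_expand`, `sum_markWeight`). The resulting transfer operator counts the same Motzkin paths up to
a normalization (`prod_qInt_mul_transfer`), hence
`∑ q^{2 res + les} t^{valleys} u^{double ascents} = motzkin q t u (n - 1) 0`
(`sum_valleys_eq_motzkin`). With `u = 1 + t`, and since there are `n - 1 - 2k` double ascents when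
there are `k` valleys and no double descents, this is the expansion.

For the divisibility, put `u = 1`: a path that contributes to `t^k` has `k` falls, and each fall
contributes a factor `w_h w_{h+1}`, a multiple of `q (1 + q)` because one of `h` and `h + 1` is even.
-/

namespace InvExc

/-! ### Motzkin paths -/

section Weights

variable {R : Type*} [CommRing R]

/-- The weight `q^{h-1} [h]_q = q^{h-1} + q^h + ⋯ + q^{2h-2}`, which is the `(p,q)`-integer
`[h]_{p,q}` at `p = q²`. It vanishes for `h = 0`. -/
def qInt (q : R) (h : ℕ) : R := ∑ i ∈ Finset.range h, q ^ (h - 1 + i)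

@[simp] theorem qInt_zero (q : R) : qInt q 0 = 0 := by simp [qInt]

@[simp] theorem qInt_one (q : R) : qInt q 1 = 1 := by simp [qInt]

/-- Total weight of the Motzkin paths with `m` steps from height `h` to height `0`, where a rise has
weight `1`, a level step at height `h` has weight `u * qInt q (h + 1)`, and a fall from height `h`
has weight `t * qInt q h * qInt q (h + 1)`. -/
def motzkin (q t u : R) : ℕ → ℕ → R
  | 0, h => if h = 0 then 1 else 0
  | m + 1, 0 => motzkin q t u m 1 + u * qInt q 1 * motzkin q t u m 0
  | m + 1, h + 1 => motzkin q t u m (h + 2) + u * qInt q (h + 2) * motzkin q t u m (h + 1)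
      + t * qInt q (h + 1) * qInt q (h + 2) * motzkin q t u m h

end Weights

/-! ### Permutations with an empty corner, by inversions and excedances -/

theorem word_zero {n : ℕ} (σ : Equiv.Perm (Fin n)) : word σ 0 = 0 := by simp [word]

theorem word_succ_self {n : ℕ} (σ : Equiv.Perm (Fin n)) : word σ (n + 1) = 0 := by simp [word]

theorem word_fin_succ {n : ℕ} (σ : Equiv.Perm (Fin n)) (i : Fin n) :
    word σ (i + 1) = (σ i : ℕ) + 1 := by
  simp [word]

theorem sum_Icc_one {M : Type*} [AddCommMonoid M] (n : ℕ) (g : ℕ → M) :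
    ∑ i ∈ Finset.Icc 1 n, g i = ∑ i : Fin n, g (i + 1) := by
  rw [← Finset.sum_range (fun i => g (i + 1)), Finset.range_eq_Ico,
    Finset.sum_Ico_add' g 0 n 1]
  rfl

theorem inv_eq_sum {n : ℕ} (σ : Equiv.Perm (Fin n)) :
    inv σ = ∑ i : Fin n, ∑ j : Fin n, if i < j ∧ σ j < σ i then 1 else 0 := by
  simp only [inv, Finset.card_filter, Finset.sum_product, sum_Icc_one, word_fin_succ]
  simp

theorem exc_eq_sum {n : ℕ} (σ : Equiv.Perm (Fin n)) :
    exc σ = ∑ i : Fin n, if i < σ i then 1 else 0 := by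
  simp only [exc, Finset.card_filter, sum_Icc_one, word_fin_succ]
  simp

/-- The permutation of `Fin (n + 1)` whose matrix is that of `τ` with a new row `r` and a new column
`c` that meet in a new entry `1`. -/
def insertCell {n : ℕ} (r c : Fin (n + 1)) (τ : Equiv.Perm (Fin n)) : Equiv.Perm (Fin (n + 1)) :=
  (finSuccEquiv' r).trans ((Equiv.optionCongr τ).trans (finSuccEquiv' c).symm)

@[simp] theorem insertCell_self {n : ℕ} (r c : Fin (n + 1)) (τ : Equiv.Perm (Fin n)) :
    insertCell r c τ r = c := by
  simp [insertCell]

@[simp] theorem insertCell_succAbove {n : ℕ} (r c : Fin (n + 1)) (τ : Equiv.Perm (Fin n))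
    (i : Fin n) : insertCell r c τ (r.succAbove i) = c.succAbove (τ i) := by
  simp [insertCell]

theorem insertCell_injective {n : ℕ} (r c : Fin (n + 1)) :
    Function.Injective (insertCell r c) := by
  intro τ τ' h
  refine Equiv.ext fun i => ?_
  have := congrArg (fun σ : Equiv.Perm (Fin (n + 1)) => σ (r.succAbove i)) h
  simpa using this

theorem insertCell_row_bijective {n : ℕ} (r : Fin (n + 1)) :
    Function.Bijective fun x : Fin (n + 1) × Equiv.Perm (Fin n) => insertCell r x.1 x.2 := by
  rw [Fintype.bijective_iff_injective_and_card]
  refine ⟨?_, by simp [Fintype.card_perm, Nat.factorial_succ]⟩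
  rintro ⟨c, τ⟩ ⟨c', τ'⟩ h
  obtain rfl : c = c' := by
    simpa using congrArg (fun σ : Equiv.Perm (Fin (n + 1)) => σ r) h
  obtain rfl := insertCell_injective r c h
  rfl

theorem insertCell_column_bijective {n : ℕ} (c : Fin (n + 1)) :
    Function.Bijective fun x : Fin (n + 1) × Equiv.Perm (Fin n) => insertCell x.1 c x.2 := by
  rw [Fintype.bijective_iff_injective_and_card]
  refine ⟨?_, by simp [Fintype.card_perm, Nat.factorial_succ]⟩
  rintro ⟨r, τ⟩ ⟨r', τ'⟩ h
  obtain rfl : r = r' := by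
    apply (insertCell r c τ).injective
    rw [insertCell_self, show insertCell r c τ = insertCell r' c τ' from h, insertCell_self]
  obtain rfl := insertCell_injective r c h
  rfl

theorem sum_val_lt {n : ℕ} (c : ℕ) (hc : c ≤ n) :
    (∑ i : Fin n, if (i : ℕ) < c then 1 else 0) = c := by
  rw [Fin.sum_univ_eq_sum_range (fun i => if i < c then 1 else 0), ← Finset.card_filter]
  have : (Finset.range n).filter (· < c) = Finset.range c := by
    ext; simp; omega
  rw [this, Finset.card_range]

theorem lt_succAbove_iff_val {n : ℕ} (r : Fin (n + 1)) (i : Fin n) :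
    r < r.succAbove i ↔ (r : ℕ) ≤ i := by
  rw [Fin.lt_succAbove_iff_le_castSucc, Fin.le_def, Fin.val_castSucc]

theorem succAbove_lt_iff_val {n : ℕ} (r : Fin (n + 1)) (i : Fin n) :
    r.succAbove i < r ↔ (i : ℕ) < r := by
  rw [Fin.succAbove_lt_iff_castSucc_lt, Fin.lt_def, Fin.val_castSucc]

/-- If the rows of `τ` above the new row have their entries weakly to the right of the new column,
then these rows and the columns to the left of the new one account for all new inversions. -/
theorem inv_insertCell {n : ℕ} (r c : Fin (n + 1)) (τ : Equiv.Perm (Fin n))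
    (h : ∀ i : Fin n, (i : ℕ) < r → (c : ℕ) ≤ τ i) :
    inv (insertCell r c τ) = inv τ + r + c := by
  rw [inv_eq_sum, inv_eq_sum, Fin.sum_univ_succAbove _ r]
  simp only [Fin.sum_univ_succAbove _ r, insertCell_self, insertCell_succAbove,
    Fin.succAbove_lt_succAbove_iff, lt_succAbove_iff_val, succAbove_lt_iff_val,
    Finset.sum_add_distrib, lt_irrefl, false_and, if_false, zero_add]
  have h1 : (∑ i : Fin n, if (r : ℕ) ≤ i ∧ (τ i : ℕ) < c then 1 else 0) = (c : ℕ) := by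
    refine Eq.trans ?_ (sum_val_lt (n := n) (c : ℕ) (by omega))
    rw [← Equiv.sum_comp τ (fun i : Fin n => if (i : ℕ) < c then 1 else 0)]
    refine Finset.sum_congr rfl fun i _ => if_congr ?_ rfl rfl
    have := h i
    omega
  have h2 : (∑ i : Fin n, if (i : ℕ) < r ∧ (c : ℕ) ≤ τ i then 1 else 0) = (r : ℕ) := by
    refine Eq.trans ?_ (sum_val_lt (n := n) (r : ℕ) (by omega))
    refine Finset.sum_congr rfl fun i _ => if_congr ?_ rfl rfl
    have := h i
    omega
  rw [h1, h2]
  omega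

theorem exc_insertCell {n : ℕ} (r c : Fin (n + 1)) (τ : Equiv.Perm (Fin n))
    (h : ∀ i : Fin n, r.succAbove i < c.succAbove (τ i) ↔ i < τ i) :
    exc (insertCell r c τ) = exc τ + if r < c then 1 else 0 := by
  rw [exc_eq_sum, exc_eq_sum, Fin.sum_univ_succAbove _ r]
  simp only [insertCell_self, insertCell_succAbove, h]
  omega

/-- The monomial `q^{inv σ - exc σ} t^{exc σ}`. -/
noncomputable def invExcWeight {n : ℕ} (σ : Equiv.Perm (Fin n)) : ℤ[T;T⁻¹][X] :=
  C (LaurentPolynomial.T ((inv σ : ℤ) - (exc σ : ℤ))) * X ^ exc σ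

/-- The permutations of `Fin n` whose matrix has no entry `1` in the upper left `a × b` corner. -/
def cornerFree (n a b : ℕ) : Finset (Equiv.Perm (Fin n)) :=
  Finset.univ.filter fun σ => ∀ i : Fin n, (i : ℕ) < a → b ≤ σ i

/-- Generating polynomial by `inv - exc` and `exc` of the permutations with an empty corner. -/
noncomputable def cornerSum (n a b : ℕ) : ℤ[T;T⁻¹][X] := ∑ σ ∈ cornerFree n a b, invExcWeight σ

/-- The variable `q`, as a constant polynomial over `ℤ[q, q⁻¹]`. -/
noncomputable def qVar : ℤ[T;T⁻¹][X] := C (LaurentPolynomial.T 1)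

theorem qVar_pow (m : ℕ) : qVar ^ m = C (LaurentPolynomial.T m) := by
  rw [qVar, ← map_pow, LaurentPolynomial.T_pow]
  simp

theorem val_succAbove {n : ℕ} (r : Fin (n + 1)) (i : Fin n) :
    ((r.succAbove i : Fin (n + 1)) : ℕ) = if (i : ℕ) < r then (i : ℕ) else i + 1 := by
  simp only [Fin.succAbove, Fin.lt_def, Fin.val_castSucc]
  split_ifs <;> simp

/-- Splits a sum over `A` into the part over `B` and the part over permutations obtained by inserting
a new cell at one of `k` places into an element of `D`, when the new cell at place `i` contributes the
factor `z * q ^ (k - 1 + i)`. -/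
theorem sum_invExcWeight_insert {n k : ℕ} (hk : k ≤ n + 1) (z : ℤ[T;T⁻¹][X])
    {F : Fin (n + 1) × Equiv.Perm (Fin n) → Equiv.Perm (Fin (n + 1))} (hF : Function.Bijective F)
    {A B : Finset (Equiv.Perm (Fin (n + 1)))} (hBA : B ⊆ A) {D : Finset (Equiv.Perm (Fin n))}
    (key : ∀ (i : Fin (n + 1)) τ, F (i, τ) ∈ A ∧ F (i, τ) ∉ B ↔ (i : ℕ) < k ∧ τ ∈ D)
    (wt : ∀ (i : Fin (n + 1)) τ, (i : ℕ) < k → τ ∈ D →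
      invExcWeight (F (i, τ)) = z * qVar ^ (k - 1 + i) * invExcWeight τ) :
    ∑ σ ∈ A, invExcWeight σ =
      ∑ σ ∈ B, invExcWeight σ + z * qInt qVar k * ∑ τ ∈ D, invExcWeight τ := by
  rw [← Finset.sum_sdiff hBA, add_comm]
  congr 1
  calc ∑ σ ∈ A \ B, invExcWeight σ
      = ∑ x ∈ (Finset.univ.filter fun i : Fin (n + 1) => (i : ℕ) < k) ×ˢ D,
          invExcWeight (F x) := by
        symm
        refine Finset.sum_bij (fun x _ => F x) ?_ ?_ ?_ ?_
        · intro x hx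
          rw [Finset.mem_sdiff, key]
          simpa using hx
        · intro x _ y _ hxy
          exact hF.1 hxy
        · intro σ hσ
          obtain ⟨x, rfl⟩ := hF.2 σ
          rw [Finset.mem_sdiff, key] at hσ
          exact ⟨x, by simpa using hσ, rfl⟩
        · intros; rfl
    _ = ∑ x ∈ (Finset.univ.filter fun i : Fin (n + 1) => (i : ℕ) < k) ×ˢ D,
          z * qVar ^ (k - 1 + (x.1 : ℕ)) * invExcWeight x.2 := by
        refine Finset.sum_congr rfl fun x hx => ?_
        simp only [Finset.mem_product, Finset.mem_filter, Finset.mem_univ, true_and] at hx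
        exact wt _ _ hx.1 hx.2
    _ = z * qInt qVar k * ∑ τ ∈ D, invExcWeight τ := by
        rw [Finset.sum_product]
        dsimp only
        rw [← Finset.sum_mul_sum, ← Finset.mul_sum]
        congr 2
        rw [Finset.sum_filter, Fin.sum_univ_eq_sum_range
          (fun i => if i < k then qVar ^ (k - 1 + i) else 0), ← Finset.sum_filter, qInt]
        refine Finset.sum_congr ?_ fun i _ => rfl
        ext; simp; omega

/-- Filling column `h + 1`: its entry lies either below the corner or in one of the first `h + 1`
rows, and in the latter case it is an excedance whose removal leaves an `h × (h + 1)` corner. -/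
theorem cornerSum_column {n h : ℕ} (hn : h < n) :
    cornerSum (n + 1) (h + 1) (h + 1) =
      cornerSum (n + 1) (h + 1) (h + 2) + X * qInt qVar (h + 1) * cornerSum n h (h + 1) := by
  set c : Fin (n + 1) := ⟨h + 1, by omega⟩ with hc
  have key : ∀ (r : Fin (n + 1)) (τ : Equiv.Perm (Fin n)),
      (insertCell r c τ ∈ cornerFree (n + 1) (h + 1) (h + 1) ∧
        ¬ insertCell r c τ ∈ cornerFree (n + 1) (h + 1) (h + 2)) ↔
      (r : ℕ) < h + 1 ∧ τ ∈ cornerFree n h (h + 1) := by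
    intro r τ
    simp only [cornerFree, Finset.mem_filter, Finset.mem_univ, true_and, Fin.forall_iff_succAbove r,
      insertCell_self, insertCell_succAbove, val_succAbove, hc]
    constructor
    · rintro ⟨⟨h1, h2⟩, h3⟩
      have hr : (r : ℕ) < h + 1 := by
        by_contra hr
        refine h3 ⟨fun h => absurd h hr, fun i hi => ?_⟩
        have := h2 i hi
        split_ifs at * <;> omega
      refine ⟨hr, fun i hi => ?_⟩
      have := h2 i (by split_ifs <;> omega)
      split_ifs at this <;> omega
    · rintro ⟨hr, h2⟩
      refine ⟨⟨fun _ => le_rfl, fun i hi => ?_⟩, fun h3 => ?_⟩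
      · have := h2 i (by split_ifs at hi <;> omega)
        split_ifs <;> omega
      · have := h3.1 hr
        omega
  have wt : ∀ (r : Fin (n + 1)) (τ : Equiv.Perm (Fin n)), (r : ℕ) < h + 1 →
      τ ∈ cornerFree n h (h + 1) →
      invExcWeight (insertCell r c τ) = X * qVar ^ (h + r) * invExcWeight τ := by
    intro r τ hr hτ
    simp only [cornerFree, Finset.mem_filter, Finset.mem_univ, true_and] at hτ
    have hi : inv (insertCell r c τ) = inv τ + r + c :=
      inv_insertCell r c τ fun i hi => hτ i (by omega)
    have he : exc (insertCell r c τ) = exc τ + 1 := by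
      rw [exc_insertCell, if_pos (Fin.lt_def.2 hr)]
      intro i
      have := hτ i
      rw [Fin.lt_def, Fin.lt_def, val_succAbove, val_succAbove]
      simp only [hc]
      split_ifs <;> omega
    rw [invExcWeight, invExcWeight, hi, he, qVar_pow, pow_succ,
      show ((inv τ + r + c : ℕ) : ℤ) - ((exc τ + 1 : ℕ) : ℤ) =
        ((h + r : ℕ) : ℤ) + ((inv τ : ℤ) - exc τ) by simp only [hc]; push_cast; ring,
      LaurentPolynomial.T_add, map_mul]
    ring
  have hsub : cornerFree (n + 1) (h + 1) (h + 2) ⊆ cornerFree (n + 1) (h + 1) (h + 1) := by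
    intro σ
    simp only [cornerFree, Finset.mem_filter, Finset.mem_univ, true_and]
    intro hσ i hi
    have := hσ i hi
    omega
  exact sum_invExcWeight_insert (by omega) X (insertCell_column_bijective c) hsub key wt

/-- Filling row `h`: its entry lies either to the right of the corner or in one of the first `h + 1`
columns, and in the latter case it is not an excedance and its removal leaves an `h × h` corner. -/
theorem cornerSum_row {n h : ℕ} (hn : h ≤ n) :
    cornerSum (n + 1) h (h + 1) =
      cornerSum (n + 1) (h + 1) (h + 1) + qInt qVar (h + 1) * cornerSum n h h := by
  set r : Fin (n + 1) := ⟨h, by omega⟩ with hr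
  have key : ∀ (c : Fin (n + 1)) (τ : Equiv.Perm (Fin n)),
      (insertCell r c τ ∈ cornerFree (n + 1) h (h + 1) ∧
        ¬ insertCell r c τ ∈ cornerFree (n + 1) (h + 1) (h + 1)) ↔
      (c : ℕ) < h + 1 ∧ τ ∈ cornerFree n h h := by
    intro c τ
    simp only [cornerFree, Finset.mem_filter, Finset.mem_univ, true_and, Fin.forall_iff_succAbove r,
      insertCell_self, insertCell_succAbove, val_succAbove, hr]
    constructor
    · rintro ⟨⟨h1, h2⟩, h3⟩
      have hc : (c : ℕ) < h + 1 := by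
        by_contra hc
        refine h3 ⟨fun _ => by omega, fun i hi => ?_⟩
        have := h2 i
        split_ifs at * <;> omega
      refine ⟨hc, fun i hi => ?_⟩
      have := h2 i (by split_ifs; omega)
      split_ifs at this <;> omega
    · rintro ⟨hc, h2⟩
      refine ⟨⟨fun hlt => absurd hlt (lt_irrefl _), fun i hi => ?_⟩, fun h3 => ?_⟩
      · have := h2 i (by split_ifs at hi <;> omega)
        split_ifs <;> omega
      · have := h3.1 (by omega)
        omega
  have wt : ∀ (c : Fin (n + 1)) (τ : Equiv.Perm (Fin n)), (c : ℕ) < h + 1 →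
      τ ∈ cornerFree n h h →
      invExcWeight (insertCell r c τ) = 1 * qVar ^ (h + c) * invExcWeight τ := by
    intro c τ hc hτ
    simp only [cornerFree, Finset.mem_filter, Finset.mem_univ, true_and] at hτ
    have hi : inv (insertCell r c τ) = inv τ + r + c :=
      inv_insertCell r c τ fun i hi => (Nat.le_of_lt_succ hc).trans (hτ i hi)
    have he : exc (insertCell r c τ) = exc τ := by
      rw [exc_insertCell, if_neg (by rw [Fin.lt_def]; simp only [hr]; omega), add_zero]
      intro i
      have := hτ i
      rw [Fin.lt_def, Fin.lt_def, val_succAbove, val_succAbove]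
      simp only [hr]
      split_ifs <;> omega
    rw [invExcWeight, invExcWeight, hi, he, qVar_pow,
      show ((inv τ + r + c : ℕ) : ℤ) - (exc τ : ℤ) =
        ((h + c : ℕ) : ℤ) + ((inv τ : ℤ) - exc τ) by simp only [hr]; push_cast; ring,
      LaurentPolynomial.T_add, map_mul]
    ring
  have hsub : cornerFree (n + 1) (h + 1) (h + 1) ⊆ cornerFree (n + 1) h (h + 1) := by
    intro σ
    simp only [cornerFree, Finset.mem_filter, Finset.mem_univ, true_and]
    exact fun hσ i hi => hσ i (by omega)
  have := sum_invExcWeight_insert (by omega) 1 (insertCell_row_bijective r) hsub key wt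
  rwa [one_mul] at this

theorem cornerSum_add_one_eq_motzkin (m h : ℕ) :
    cornerSum (m + h + 1) h (h + 1) = motzkin qVar X (1 + X) m h := by
  induction m generalizing h with
  | zero =>
    rw [motzkin, zero_add]
    split_ifs with hh
    · subst hh
      have : cornerFree 1 0 1 = Finset.univ := by simp [cornerFree]
      rw [zero_add, cornerSum, this]
      simp [invExcWeight, inv_eq_sum, exc_eq_sum]
    · refine Finset.sum_eq_zero fun σ hσ => ?_
      simp only [cornerFree, Finset.mem_filter, Finset.mem_univ, true_and] at hσ
      have := hσ 0 (by simp; omega)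
      omega
  | succ m ih =>
    have hrow : cornerSum (m + 1 + h + 1) h (h + 1) = cornerSum (m + h + 1 + 1) (h + 1) (h + 1) +
        qInt qVar (h + 1) * cornerSum (m + h + 1) h h := by
      rw [← cornerSum_row (by omega)]
      congr 1
      omega
    have hcol := cornerSum_column (n := m + h + 1) (h := h) (by omega)
    have h1 : cornerSum (m + h + 1 + 1) (h + 1) (h + 2) = motzkin qVar X (1 + X) m (h + 1) := by
      rw [← ih]
      congr 1
    rw [h1, ih] at hcol
    rw [hrow, hcol]
    cases h with
    | zero =>
      have h0 : cornerSum (m + 0 + 1) 0 0 = cornerSum (m + 0 + 1) 0 (0 + 1) := by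
        simp [cornerSum, cornerFree]
      rw [h0, show cornerSum (m + 0 + 1) 0 (0 + 1) = _ from ih 0, motzkin]
      ring
    | succ h =>
      have hcol' := cornerSum_column (n := m + h + 1) (h := h) (by omega)
      have h2 : cornerSum (m + h + 1 + 1) (h + 1) (h + 2) = motzkin qVar X (1 + X) m (h + 1) := by
        rw [← ih]
        congr 1
      rw [h2, ih] at hcol'
      rw [show m + (h + 1) + 1 = m + h + 1 + 1 by omega, hcol', motzkin]
      ring

theorem sum_invExcWeight_eq_motzkin (m : ℕ) :
    ∑ σ : Equiv.Perm (Fin (m + 1)), invExcWeight σ = motzkin qVar X (1 + X) m 0 := by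
  rw [← cornerSum_add_one_eq_motzkin]
  simp [cornerSum, cornerFree]

/-! ### Letter weights in words -/

/-- The number of adjacent pairs `y, z` of the list with `y < v < z`. -/
def crossings (v : ℕ) : List ℕ → ℕ
  | [] => 0
  | y :: l => (if y < v ∧ v < l.headD 0 then 1 else 0) + crossings v l

theorem headD_append_lt_iff {v : ℕ} {A B s : List ℕ} (hs : s ≠ []) (hv : ∀ x ∈ s, x < v) :
    (A ++ (s ++ B)).headD 0 < v ↔ (A ++ 0 :: B).headD 0 < v := by
  cases A with
  | cons a A => simp
  | nil =>
    cases s with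
    | nil => exact absurd rfl hs
    | cons x s =>
      have := hv x (by simp)
      simp; omega

theorem lt_headD_append_iff {v : ℕ} {A B s : List ℕ} (hs : s ≠ []) (hv : ∀ x ∈ s, x < v) :
    v < (A ++ (s ++ B)).headD 0 ↔ v < (A ++ 0 :: B).headD 0 := by
  cases A with
  | cons a A => simp
  | nil =>
    cases s with
    | nil => exact absurd rfl hs
    | cons x s =>
      have := hv x (by simp)
      simp; omega

theorem crossings_append {v : ℕ} {A B s : List ℕ} (hs : s ≠ []) (hv : ∀ x ∈ s, x < v) :
    crossings v (A ++ (s ++ B)) = crossings v (A ++ 0 :: B) := by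
  induction A with
  | cons a A ih =>
    rw [List.cons_append, List.cons_append, crossings, crossings, ih]
    simp only [lt_headD_append_iff hs hv]
  | nil =>
    rw [List.nil_append, List.nil_append]
    induction s with
    | nil => exact absurd rfl hs
    | cons x s ih =>
      have hx := hv x (by simp)
      rcases eq_or_ne s [] with rfl | hne
      · simp [crossings, hx, Nat.zero_lt_of_lt hx]
      · have hv' : ∀ x ∈ s, x < v := fun y hy => hv y (by simp [hy])
        have := lt_headD_append_iff (A := []) (B := B) hne hv'
        rw [List.cons_append, crossings, ih hne hv']
        simp only [List.nil_append, List.headD_cons, not_lt_zero, iff_false] at this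
        rw [if_neg fun h => this h.2, zero_add]

section LetterWeight

variable {R : Type*} [CommRing R] (q t u : R)

/-- The weight of a letter `v` preceded by `A.reverse` and followed by `B`, a missing neighbour
counting as `0`: a peak has weight `1`, a double ascent `u`, a double descent `0` and a valley `t`,
times `q` for every descent across `v` on its left and `q²` for every ascent across `v` on its
right. -/
def contextWeight (v : ℕ) (A B : List ℕ) : R :=
  (if A.headD 0 < v then if B.headD 0 < v then 1 else u else if B.headD 0 < v then 0 else t) *
    q ^ (2 * crossings v B + crossings v A)

/-- The weight of the first occurrence of the letter `v` in the word `w`. -/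
def letterWeight (v : ℕ) (w : List ℕ) : R :=
  contextWeight q t u v (w.takeWhile (· ≠ v)).reverse (w.dropWhile (· ≠ v)).tail

theorem letterWeight_append_cons {v : ℕ} {A B : List ℕ} (hA : v ∉ A) :
    letterWeight q t u v (A ++ v :: B) = contextWeight q t u v A.reverse B := by
  have h : ∀ a ∈ A, decide (a ≠ v) = true := by
    intro a ha
    simpa using fun h : a = v => hA (h ▸ ha)
  rw [letterWeight, List.takeWhile_append_of_pos h, List.dropWhile_append_of_pos h]
  simp

/-- The weight of a letter does not change when a block of smaller letters is contracted to `0`. -/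
theorem letterWeight_append {v : ℕ} {L R' s : List ℕ} (hs : s ≠ []) (hv : ∀ x ∈ s, x < v)
    (h : v ∈ L ++ R') :
    letterWeight q t u v (L ++ (s ++ R')) = letterWeight q t u v (L ++ 0 :: R') := by
  have hv0 : 0 < v := by
    obtain ⟨x, hx⟩ := List.exists_mem_of_ne_nil s hs
    exact Nat.zero_lt_of_lt (hv x hx)
  by_cases hL : v ∈ L
  · obtain ⟨A, B, rfl, hA⟩ := List.eq_append_cons_of_mem hL
    simp only [List.append_assoc, List.cons_append]
    rw [letterWeight_append_cons q t u hA, letterWeight_append_cons q t u hA]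
    simp only [contextWeight, headD_append_lt_iff hs hv, crossings_append hs hv]
  · obtain ⟨A, B, rfl, hA⟩ := List.eq_append_cons_of_mem
      ((List.mem_append.1 h).resolve_left hL)
    have h1 : v ∉ L ++ (s ++ A) := by
      simp only [List.mem_append, not_or]
      exact ⟨hL, fun h => (hv v h).false, hA⟩
    have h2 : v ∉ L ++ 0 :: A := by
      simp only [List.mem_append, List.mem_cons, not_or]
      exact ⟨hL, hv0.ne', hA⟩
    rw [show L ++ (s ++ (A ++ v :: B)) = L ++ (s ++ A) ++ v :: B by simp,
      show L ++ 0 :: (A ++ v :: B) = L ++ 0 :: A ++ v :: B by simp,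
      letterWeight_append_cons q t u h1, letterWeight_append_cons q t u h2]
    have hs' : s.reverse ≠ [] := by simpa using hs
    have hv' : ∀ x ∈ s.reverse, x < v := by simpa using hv
    simp only [contextWeight, List.reverse_append, List.reverse_cons, List.append_assoc,
      List.singleton_append, headD_append_lt_iff hs' hv', crossings_append hs' hv']

end LetterWeight

/-! ### Block words -/

/-- A list that ends with `0` and has no two adjacent zeros. The part of a block word on either side
of a letter, read away from that letter, has this form. -/
def IsSide (B : List ℕ) : Prop :=
  B.getLast? = some 0 ∧ B.IsChain fun x y => x ≠ 0 ∨ y ≠ 0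

theorem not_isSide_nil : ¬ IsSide [] := by simp [IsSide]

theorem IsSide.ne_nil {B : List ℕ} (h : IsSide B) : B ≠ [] := by
  rintro rfl; exact not_isSide_nil h

theorem isSide_zero_cons {B : List ℕ} :
    IsSide (0 :: B) ↔ B = [] ∨ (B.headD 0 ≠ 0 ∧ IsSide B) := by
  cases B with
  | nil => simp [IsSide]
  | cons b B => simp [IsSide, List.isChain_cons_cons]; tauto

theorem isSide_cons {b : ℕ} (hb : b ≠ 0) {B : List ℕ} : IsSide (b :: B) ↔ IsSide B := by
  cases B with
  | nil => simp [IsSide, hb]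
  | cons b' B => simp [IsSide, List.isChain_cons_cons, hb]

theorem crossings_add_one {v : ℕ} {B : List ℕ} (hB : IsSide B) (hv : 0 < v)
    (h : ∀ x ∈ B, x ≠ 0 → v < x) : crossings v B + 1 = B.count 0 := by
  induction B with
  | nil => exact absurd hB not_isSide_nil
  | cons b B ih =>
    have h' : ∀ x ∈ B, x ≠ 0 → v < x := fun x hx => h x (by simp [hx])
    rcases eq_or_ne b 0 with rfl | hb
    · rcases isSide_zero_cons.1 hB with rfl | ⟨h0, hB'⟩
      · simp [crossings]
      · have := ih hB' h'
        have hlt : v < B.headD 0 := by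
          cases B with
          | nil => exact absurd rfl h0
          | cons c B => exact h' c (by simp) h0
        rw [crossings, if_pos ⟨hv, hlt⟩, List.count_cons_self]
        omega
    · have := ih ((isSide_cons hb).1 hB) h'
      have hlt := h b (by simp) hb
      rw [crossings, if_neg (by omega), List.count_cons_of_ne hb]
      omega

/-- A word that starts and ends with `0` and has no two adjacent zeros, and whose nonzero letters
are the elements of the interval `(m, n]`, each occurring once. It records the order of the letters
exceeding `m` in the one-line notation of a permutation of `{1, …, n}`, with every block of smaller
letters, boundary values `0` included, contracted to one `0`. -/
structure IsBlockWord (m n : ℕ) (w : List ℕ) : Prop where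
  isSide : IsSide w
  isSide_reverse : IsSide w.reverse
  count_eq : ∀ v, v ≠ 0 → w.count v = if m < v ∧ v ≤ n then 1 else 0

theorem IsSide.isChain_reverse_append {x : ℕ} {B : List ℕ} (h : IsSide (x :: B)) :
    (B.reverse ++ [x]).IsChain fun x y => x ≠ 0 ∨ y ≠ 0 := by
  rw [← List.reverse_cons, List.isChain_reverse]
  exact h.2.imp fun _ _ => Or.symm

theorem isSide_append_cons {x : ℕ} {A B : List ℕ} :
    IsSide (A ++ x :: B) ↔ IsSide (x :: B) ∧ (A ++ [x]).IsChain fun x y => x ≠ 0 ∨ y ≠ 0 := by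
  simp only [IsSide, List.isChain_append, List.getLast?_append_cons, List.head?_cons,
    List.isChain_singleton]
  tauto

theorem isSide_append_and_reverse {x : ℕ} {L R : List ℕ} :
    IsSide (L ++ x :: R) ∧ IsSide (L ++ x :: R).reverse ↔
      IsSide (x :: L.reverse) ∧ IsSide (x :: R) := by
  have hrev : (L ++ x :: R).reverse = R.reverse ++ x :: L.reverse := by simp
  rw [hrev, isSide_append_cons, isSide_append_cons]
  constructor
  · exact fun h => ⟨h.2.1, h.1.1⟩
  · refine fun h => ⟨⟨h.2, ?_⟩, h.1, h.2.isChain_reverse_append⟩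
    simpa using h.1.isChain_reverse_append

/-- The two ways to place a new letter next to the side `B` of a contracted block: the block survives
on this side of the letter, or it does not. -/
def expandSide (B : List ℕ) : List (List ℕ) := (0 :: B) :: if B = [] then [] else [B]

/-- Undoes `expandSide`. -/
def stripSide : List ℕ → List ℕ
  | 0 :: B => B
  | B => B

theorem stripSide_of_mem_expandSide {A B : List ℕ} (hB : IsSide (0 :: B))
    (hA : A ∈ expandSide B) : stripSide A = B := by
  rw [expandSide] at hA
  rcases isSide_zero_cons.1 hB with rfl | ⟨h0, hB'⟩
  · simp only [if_true, List.mem_singleton] at hA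
    subst hA; rfl
  · rw [if_neg hB'.ne_nil] at hA
    simp only [List.mem_cons, List.not_mem_nil, or_false] at hA
    rcases hA with rfl | rfl
    · rfl
    · cases A with
      | nil => rfl
      | cons a A =>
        cases a with
        | zero => exact absurd rfl h0
        | succ a => rfl

theorem isSide_of_mem_expandSide {A B : List ℕ} (hB : IsSide (0 :: B)) (hA : A ∈ expandSide B) :
    IsSide A := by
  rw [expandSide] at hA
  rcases isSide_zero_cons.1 hB with rfl | ⟨h0, hB'⟩
  · simp only [if_true, List.mem_singleton] at hA
    subst hA; exact hB
  · rw [if_neg hB'.ne_nil] at hA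
    simp only [List.mem_cons, List.not_mem_nil, or_false] at hA
    rcases hA with rfl | rfl
    · exact hB
    · exact hB'

theorem mem_expandSide_stripSide {A : List ℕ} (hA : IsSide A) :
    IsSide (0 :: stripSide A) ∧ A ∈ expandSide (stripSide A) := by
  cases A with
  | nil => exact absurd hA not_isSide_nil
  | cons a A =>
    cases a with
    | zero => exact ⟨hA, by simp [stripSide, expandSide]⟩
    | succ a =>
      refine ⟨isSide_zero_cons.2 (Or.inr ⟨by simp [stripSide], hA⟩), ?_⟩
      simp [stripSide, expandSide]

theorem count_of_mem_expandSide {v : ℕ} (hv : v ≠ 0) {A B : List ℕ} (hA : A ∈ expandSide B) :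
    A.count v = B.count v := by
  rw [expandSide] at hA
  split_ifs at hA <;> simp only [List.mem_cons, List.not_mem_nil, or_false] at hA
  · subst hA; rw [List.count_cons_of_ne hv.symm]
  · rcases hA with rfl | rfl
    · rw [List.count_cons_of_ne hv.symm]
    · rfl

/-- All ways to mark a `0` of the word: pairs of the part before it, reversed, and the part after
it. -/
def zeroMarks : List ℕ → List (List ℕ × List ℕ)
  | [] => []
  | x :: l => (if x = 0 then [([], l)] else []) ++
      (zeroMarks l).map fun p => (p.1 ++ [x], p.2)

theorem mem_zeroMarks {w : List ℕ} {p : List ℕ × List ℕ} :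
    p ∈ zeroMarks w ↔ w = p.1.reverse ++ 0 :: p.2 := by
  induction w generalizing p with
  | nil => simp [zeroMarks]
  | cons x l ih =>
    obtain ⟨L, R⟩ := p
    rw [zeroMarks, List.mem_append, List.mem_map]
    rcases List.eq_nil_or_concat L with rfl | ⟨L, y, rfl⟩
    · simp
      exact fun _ => eq_comm
    · have : (L.concat y, R) ∉ (if x = 0 then [(([] : List ℕ), l)] else []) := by
        split_ifs <;> simp
      simp only [this, false_or]
      constructor
      · rintro ⟨⟨L', R'⟩, h1, h2⟩
        rw [ih] at h1
        simp at h2 h1 ⊢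
        obtain ⟨⟨rfl, rfl⟩, rfl⟩ := h2
        exact ⟨rfl, h1⟩
      · intro h
        simp at h
        exact ⟨(L, R), ih.2 h.2, by simp [h.1]⟩

theorem nodup_zeroMarks (w : List ℕ) : (zeroMarks w).Nodup := by
  induction w with
  | nil => simp [zeroMarks]
  | cons x l ih =>
    rw [zeroMarks]
    refine List.Nodup.append (by split_ifs <;> simp) (ih.map ?_) ?_
    · rintro ⟨L, R⟩ ⟨L', R'⟩ h
      simpa using h
    · split_ifs <;> simp

theorem sum_zeroMarks {M : Type*} [AddCommMonoid M] (w : List ℕ) (f : ℕ → ℕ → M) :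
    ((zeroMarks w).map fun p => f (p.1.count 0) (p.2.count 0)).sum =
      ∑ g ∈ Finset.range (w.count 0), f g (w.count 0 - 1 - g) := by
  induction w generalizing f with
  | nil => simp [zeroMarks]
  | cons x l ih =>
    rw [zeroMarks, List.map_append, List.sum_append, List.map_map]
    rcases eq_or_ne x 0 with rfl | hx
    · have := ih fun g d => f (g + 1) d
      simp only [Function.comp_def, List.count_append, List.count_singleton_self, if_true] at *
      rw [this, List.count_cons_self, Finset.sum_range_succ', add_comm]
      congr 1
      · refine Finset.sum_congr rfl fun g hg => ?_
        congr 1; omega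
      · simp
    · have := ih f
      simp only [Function.comp_def, List.count_append, hx, if_false, List.map_nil, List.sum_nil,
        zero_add, List.count_cons_of_ne hx] at *
      simpa [List.count_cons_of_ne hx] using this

/-- The words obtained from a marked word by putting the letter `v` in place of the marked `0`, with
or without a `0` on either side of it. -/
def expand (v : ℕ) (p : List ℕ × List ℕ) : List (List ℕ) :=
  (expandSide p.1 ×ˢ expandSide p.2).map fun x => x.1.reverse ++ v :: x.2

theorem mem_expand {v : ℕ} {p : List ℕ × List ℕ} {w : List ℕ} :
    w ∈ expand v p ↔ ∃ A ∈ expandSide p.1, ∃ B ∈ expandSide p.2, A.reverse ++ v :: B = w := by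
  simp [expand, and_assoc]

/-- The list of all block words with the `N` letters `n - N + 1, …, n`. -/
def blockWords (n : ℕ) : ℕ → List (List ℕ)
  | 0 => [[0]]
  | N + 1 => ((blockWords n N).flatMap zeroMarks).flatMap (expand (n - N))

theorem mem_blockWords {n N : ℕ} (hN : N ≤ n) {w : List ℕ} :
    w ∈ blockWords n N ↔ IsBlockWord (n - N) n w := by
  induction N generalizing w with
  | zero =>
    simp only [blockWords, List.mem_singleton, Nat.sub_zero]
    constructor
    · rintro rfl
      refine ⟨by simp [IsSide], by simp [IsSide], fun v hv => ?_⟩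
      rw [if_neg (by omega), List.count_cons_of_ne hv.symm, List.count_nil]
    · intro h
      have h0 : ∀ x ∈ w, x = 0 := by
        intro x hx
        by_contra hx0
        have := h.count_eq x hx0
        rw [if_neg (by omega), List.count_eq_zero] at this
        exact this hx
      match w, h0, h.isSide with
      | [], _, hs => exact absurd hs not_isSide_nil
      | [a], h0, _ => simpa using h0
      | a :: b :: l, h0, hs =>
        have ha := h0 a (by simp)
        have hb := h0 b (by simp)
        have := hs.2
        simp [List.isChain_cons_cons, ha, hb] at this
  | succ N ih =>
    have hv : n - N ≠ 0 := by omega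
    simp only [blockWords, List.mem_flatMap, mem_expand, mem_zeroMarks]
    constructor
    · rintro ⟨⟨L, R⟩, ⟨w', hw', rfl⟩, A, hA, B, hB, rfl⟩
      rw [ih (by omega)] at hw'
      have hs := isSide_append_and_reverse.1 ⟨hw'.isSide, hw'.isSide_reverse⟩
      rw [List.reverse_reverse] at hs
      have hs' : IsSide (A.reverse ++ (n - N) :: B) ∧ IsSide (A.reverse ++ (n - N) :: B).reverse := by
        rw [isSide_append_and_reverse, isSide_cons hv, isSide_cons hv, List.reverse_reverse]
        exact ⟨isSide_of_mem_expandSide hs.1 hA, isSide_of_mem_expandSide hs.2 hB⟩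
      refine ⟨hs'.1, hs'.2, fun v hv0 => ?_⟩
      have hc := hw'.count_eq v hv0
      rw [List.count_append, List.count_reverse, List.count_cons_of_ne hv0.symm] at hc
      rw [List.count_append, List.count_reverse, List.count_cons, count_of_mem_expandSide hv0 hA,
        count_of_mem_expandSide hv0 hB]
      simp only [beq_iff_eq]
      dsimp only at hc ⊢
      split_ifs at * <;> omega
    · intro h
      have hmem : n - N ∈ w := by
        rw [← List.count_pos_iff, h.count_eq _ hv, if_pos (by omega)]
        exact one_pos
      obtain ⟨A, B, rfl⟩ := List.mem_iff_append.1 hmem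
      have hs := isSide_append_and_reverse.1 ⟨h.isSide, h.isSide_reverse⟩
      rw [isSide_cons hv, isSide_cons hv] at hs
      have hA := mem_expandSide_stripSide hs.1
      have hB := mem_expandSide_stripSide hs.2
      refine ⟨(stripSide A.reverse, stripSide B), ⟨_, ?_, rfl⟩, A.reverse, hA.2, B, hB.2, by simp⟩
      rw [ih (by omega)]
      have hs' : IsSide ((stripSide A.reverse).reverse ++ 0 :: stripSide B) ∧
          IsSide ((stripSide A.reverse).reverse ++ 0 :: stripSide B).reverse := by
        rw [isSide_append_and_reverse, List.reverse_reverse]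
        exact ⟨hA.1, hB.1⟩
      refine ⟨hs'.1, hs'.2, fun v hv0 => ?_⟩
      have hc := h.count_eq v hv0
      rw [List.count_append, ← List.count_reverse, List.count_cons,
        count_of_mem_expandSide hv0 hA.2, count_of_mem_expandSide hv0 hB.2] at hc
      rw [List.count_append, List.count_reverse, List.count_cons_of_ne hv0.symm]
      simp only [beq_iff_eq] at hc
      dsimp only
      split_ifs at * <;> omega

theorem not_mem_of_mem_expandSide {v : ℕ} (hv : v ≠ 0) {A B : List ℕ} (hB : v ∉ B)
    (hA : A ∈ expandSide B) : v ∉ A := by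
  rwa [← List.count_eq_zero, count_of_mem_expandSide hv hA, List.count_eq_zero]

theorem append_cons_inj {v : ℕ} {A A' B B' : List ℕ} (hA : v ∉ A) (hA' : v ∉ A')
    (h : A.reverse ++ v :: B = A'.reverse ++ v :: B') : A = A' ∧ B = B' := by
  have hlen : A.reverse.length = A'.reverse.length := by
    have := congrArg (List.idxOf v) h
    rwa [List.idxOf_append_of_notMem (by simpa using hA),
      List.idxOf_append_of_notMem (by simpa using hA'), List.idxOf_cons_self, List.idxOf_cons_self,
      add_zero, add_zero] at this
  simpa using List.append_inj h hlen

/-- A word with a letter `v` arises by expansion from at most one marked word. -/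
theorem eq_of_mem_expand {v : ℕ} (hv : v ≠ 0) {p p' : List ℕ × List ℕ} {w : List ℕ}
    (h1 : IsSide (0 :: p.1)) (h2 : IsSide (0 :: p.2)) (hp : v ∉ p.1)
    (h1' : IsSide (0 :: p'.1)) (h2' : IsSide (0 :: p'.2)) (hp' : v ∉ p'.1)
    (hw : w ∈ expand v p) (hw' : w ∈ expand v p') : p = p' := by
  obtain ⟨A, hA, B, hB, rfl⟩ := mem_expand.1 hw
  obtain ⟨A', hA', B', hB', h⟩ := mem_expand.1 hw'
  obtain ⟨rfl, rfl⟩ := append_cons_inj (not_mem_of_mem_expandSide hv hp' hA')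
    (not_mem_of_mem_expandSide hv hp hA) h
  refine Prod.ext ?_ ?_
  · rw [← stripSide_of_mem_expandSide h1 hA, stripSide_of_mem_expandSide h1' hA']
  · rw [← stripSide_of_mem_expandSide h2 hB, stripSide_of_mem_expandSide h2' hB']

theorem nodup_expandSide (B : List ℕ) : (expandSide B).Nodup := by
  rw [expandSide]
  split_ifs
  · simp
  · simp only [List.nodup_cons, List.mem_singleton, List.not_mem_nil, not_false_eq_true,
      List.nodup_nil, and_true]
    intro h
    simpa using congrArg List.length h

theorem nodup_expand {v : ℕ} (hv : v ≠ 0) {p : List ℕ × List ℕ} (hp : v ∉ p.1) :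
    (expand v p).Nodup := by
  refine List.Nodup.map_on ?_ ((nodup_expandSide _).product (nodup_expandSide _))
  rintro ⟨A, B⟩ hx ⟨A', B'⟩ hy h
  rw [List.mem_product] at hx hy
  obtain ⟨rfl, rfl⟩ := append_cons_inj (not_mem_of_mem_expandSide hv hp hx.1)
    (not_mem_of_mem_expandSide hv hp hy.1) h
  rfl

theorem isSide_of_mem_zeroMarks {m n : ℕ} {w : List ℕ} (hw : IsBlockWord m n w)
    {p : List ℕ × List ℕ} (hp : p ∈ zeroMarks w) : IsSide (0 :: p.1) ∧ IsSide (0 :: p.2) := by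
  rw [mem_zeroMarks] at hp
  subst hp
  simpa using isSide_append_and_reverse.1 ⟨hw.isSide, hw.isSide_reverse⟩

theorem not_mem_of_mem_zeroMarks {m n : ℕ} {w : List ℕ} (hw : IsBlockWord m n w) {v : ℕ}
    (hv0 : v ≠ 0) (hv : v ≤ m) {p : List ℕ × List ℕ} (hp : p ∈ zeroMarks w) :
    v ∉ p.1 ∧ v ∉ p.2 := by
  have := hw.count_eq v hv0
  rw [if_neg (by omega), List.count_eq_zero, mem_zeroMarks.1 hp] at this
  simp at this
  tauto

theorem nodup_blockWords {n N : ℕ} (hN : N ≤ n) : (blockWords n N).Nodup := by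
  induction N with
  | zero => simp [blockWords]
  | succ N ih =>
    have hv : n - N ≠ 0 := by omega
    have hmem : ∀ p ∈ (blockWords n N).flatMap zeroMarks,
        IsSide (0 :: p.1) ∧ IsSide (0 :: p.2) ∧ n - N ∉ p.1 := by
      intro p hp
      obtain ⟨w, hw, hp⟩ := List.mem_flatMap.1 hp
      rw [mem_blockWords (by omega)] at hw
      exact ⟨(isSide_of_mem_zeroMarks hw hp).1, (isSide_of_mem_zeroMarks hw hp).2,
        (not_mem_of_mem_zeroMarks hw hv le_rfl hp).1⟩
    have hnd : ((blockWords n N).flatMap zeroMarks).Nodup := by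
      rw [List.nodup_flatMap]
      refine ⟨fun w _ => nodup_zeroMarks w, (ih (by omega)).imp fun {w w'} hne p hp hp' => hne ?_⟩
      rw [mem_zeroMarks.1 hp, mem_zeroMarks.1 hp']
    rw [blockWords, List.nodup_flatMap]
    refine ⟨fun p hp => nodup_expand hv (hmem p hp).2.2, ?_⟩
    refine (List.Pairwise.and_mem.1 hnd).imp fun {p p'} h w hw hw' => h.2.2 ?_
    have hp := hmem p h.1
    have hp' := hmem p' h.2.1
    exact eq_of_mem_expand hv hp.1 hp.2.1 hp.2.2 hp'.1 hp'.2.1 hp'.2.2 hw hw'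

/-! ### The transfer operator -/

section Transfer

variable {R : Type*} [CommRing R] (q t u : R)

/-- One step of the transfer operator: the effect on a function of the number of zeros of inserting
one more letter into a block word. -/
def transfer (φ : ℕ → R) (c : ℕ) : R :=
  qInt q c * φ (c + 1) + u * qInt q (c - 1) * φ c + t * qInt q (c - 2) * φ (c - 1)

theorem exists_block_of_mem_expand {v : ℕ} {p : List ℕ × List ℕ} {z : List ℕ}
    (hz : z ∈ expand v p) :
    ∃ s, s ≠ [] ∧ (∀ x ∈ s, x ≤ v) ∧ z = p.1.reverse ++ (s ++ p.2) := by
  have side : ∀ {A B : List ℕ}, A ∈ expandSide B → ∃ s, (∀ x ∈ s, x = 0) ∧ A = s ++ B := by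
    intro A B h
    rw [expandSide, List.mem_cons] at h
    rcases h with rfl | h
    · exact ⟨[0], by simp, rfl⟩
    · refine ⟨[], by simp, ?_⟩
      split_ifs at h
      · simp at h
      · simpa using h
  obtain ⟨A, hA, B, hB, rfl⟩ := mem_expand.1 hz
  obtain ⟨s, hs, rfl⟩ := side hA
  obtain ⟨s', hs', rfl⟩ := side hB
  refine ⟨s.reverse ++ v :: s', by simp, ?_, by simp⟩
  intro x hx
  simp only [List.mem_append, List.mem_reverse, List.mem_cons] at hx
  rcases hx with hx | hx | hx
  · simp [hs x hx]
  · exact hx.le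
  · simp [hs' x hx]

/-- The product of the weights of the letters of `(m, n]` in a block word. -/
def wordWeight (m n : ℕ) (w : List ℕ) : R := ∏ v ∈ Finset.Ioc m n, letterWeight q t u v w

theorem wordWeight_expand {v n : ℕ} (hv : 0 < v) (hvn : v ≤ n) {w : List ℕ}
    (hw : IsBlockWord v n w) {p : List ℕ × List ℕ} (hp : p ∈ zeroMarks w) {A B : List ℕ}
    (hA : A ∈ expandSide p.1) (hB : B ∈ expandSide p.2) :
    wordWeight q t u (v - 1) n (A.reverse ++ v :: B) =
      contextWeight q t u v A B * wordWeight q t u v n w := by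
  have hI : Finset.Ioc (v - 1) n = insert v (Finset.Ioc v n) := by
    ext x; simp; omega
  rw [wordWeight, hI, Finset.prod_insert (by simp)]
  have hvA : v ∉ A.reverse := by
    rw [List.mem_reverse]
    exact not_mem_of_mem_expandSide hv.ne' (not_mem_of_mem_zeroMarks hw hv.ne' le_rfl hp).1 hA
  rw [letterWeight_append_cons q t u hvA, List.reverse_reverse]
  congr 1
  refine Finset.prod_congr rfl fun x hx => ?_
  rw [Finset.mem_Ioc] at hx
  obtain ⟨s, hs, hsv, hz⟩ := exists_block_of_mem_expand (mem_expand.2 ⟨A, hA, B, hB, rfl⟩)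
  have hxw : x ∈ w := by
    rw [← List.count_pos_iff, hw.count_eq x (by omega), if_pos hx]
    exact one_pos
  rw [mem_zeroMarks] at hp
  rw [hz, letterWeight_append q t u hs (fun y hy => (hsv y hy).trans_lt hx.1), hp]
  rw [hp] at hxw
  simp only [List.mem_append, List.mem_cons] at hxw ⊢
  have : x ≠ 0 := by omega
  tauto

/-- The contribution of a marked `0` with `g` zeros before and `d` zeros after it. -/
def markWeight (φ : ℕ → R) (g d : ℕ) : R :=
  q ^ (2 * d + g) * φ (g + d + 2) +
    (if d = 0 then 0 else u * q ^ (2 * (d - 1) + g) * φ (g + d + 1)) +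
    if d = 0 then 0 else if g = 0 then 0 else t * q ^ (2 * (d - 1) + (g - 1)) * φ (g + d)

theorem sum_expand {v n : ℕ} (hv : 0 < v) (hvn : v ≤ n) {w : List ℕ} (hw : IsBlockWord v n w)
    {p : List ℕ × List ℕ} (hp : p ∈ zeroMarks w) (φ : ℕ → R) :
    ((expand v p).map fun z => wordWeight q t u (v - 1) n z * φ (z.count 0)).sum =
      wordWeight q t u v n w * markWeight q t u φ (p.1.count 0) (p.2.count 0) := by
  have hside := isSide_of_mem_zeroMarks hw hp
  have hlt : (∀ x ∈ p.1, x ≠ 0 → v < x) ∧ ∀ x ∈ p.2, x ≠ 0 → v < x := by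
    have h : ∀ x ∈ w, x ≠ 0 → v < x := by
      intro x hx hx0
      by_contra hxv
      have := hw.count_eq x hx0
      rw [if_neg (by omega), List.count_eq_zero] at this
      exact this hx
    rw [mem_zeroMarks.1 hp] at h
    exact ⟨fun x hx => h x (by simp [hx]), fun x hx => h x (by simp [hx])⟩
  -- Head, crossings and zeros of a side that starts with the surviving zero, and of one that does not.
  have hzero : ∀ {B : List ℕ}, IsSide (0 :: B) → (∀ x ∈ B, x ≠ 0 → v < x) →
      crossings v (0 :: B) = B.count 0 := by
    intro B hB h
    have := crossings_add_one hB hv (by simpa using h)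
    rw [List.count_cons_self] at this
    omega
  have hne : ∀ {B : List ℕ}, IsSide (0 :: B) → (∀ x ∈ B, x ≠ 0 → v < x) → B ≠ [] →
      ¬ B.headD 0 < v ∧ B.count 0 ≠ 0 ∧ crossings v B = B.count 0 - 1 := by
    intro B hB h hB0
    obtain ⟨h0, hB'⟩ := (isSide_zero_cons.1 hB).resolve_left hB0
    have := crossings_add_one hB' hv h
    refine ⟨?_, by omega, by omega⟩
    cases B with
    | nil => exact absurd rfl hB0
    | cons b B => exact (h b (by simp) h0).not_gt
  have hexp : ((expand v p).map fun z => wordWeight q t u (v - 1) n z * φ (z.count 0)) =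
      ((expandSide p.1 ×ˢ expandSide p.2).map fun x => wordWeight q t u v n w *
        (contextWeight q t u v x.1 x.2 * φ (x.1.count 0 + x.2.count 0))) := by
    rw [expand, List.map_map]
    refine List.map_congr_left fun x hx => ?_
    rw [List.mem_product] at hx
    dsimp only [Function.comp_apply]
    rw [wordWeight_expand q t u hv hvn hw hp hx.1 hx.2, List.count_append, List.count_reverse,
      List.count_cons_of_ne hv.ne']
    ring
  rw [hexp, List.sum_map_mul_left]
  congr 1
  obtain ⟨L, R'⟩ := p
  dsimp only at hside hlt ⊢
  have hL := hzero hside.1 hlt.1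
  have hR := hzero hside.2 hlt.2
  have hL' := hne hside.1 hlt.1
  have hR' := hne hside.2 hlt.2
  rw [markWeight]
  rcases eq_or_ne L [] with rfl | hL0 <;> rcases eq_or_ne R' [] with rfl | hR0
  · simp [expandSide, contextWeight, hv, hL]
  · obtain ⟨h1, h2, h3⟩ := hR' hR0
    simp [expandSide, contextWeight, hv, hL, hR, hR0, h1, h2, h3, -List.headD_eq_head?_getD]
    ring_nf
  · have h1 := (hL' hL0).1
    simp [expandSide, contextWeight, hv, hL, hR, hL0, h1, -List.headD_eq_head?_getD]
  · obtain ⟨h1, h2, h3⟩ := hR' hR0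
    obtain ⟨h1', h2', h3'⟩ := hL' hL0
    simp [expandSide, contextWeight, hv, hL, hR, hL0, hR0, h1, h2, h3, h1', h2', h3',
      -List.headD_eq_head?_getD]
    ring_nf

theorem sum_markWeight (φ : ℕ → R) (c : ℕ) :
    ∑ g ∈ Finset.range c, markWeight q t u φ g (c - 1 - g) = transfer q t u φ c := by
  rw [← Finset.sum_range_reflect]
  simp only [markWeight, transfer, Finset.sum_add_distrib]
  congr 1
  · congr 1
    · rw [qInt, Finset.sum_mul]
      refine Finset.sum_congr rfl fun d hd => ?_
      rw [Finset.mem_range] at hd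
      congr 2 <;> omega
    · cases c with
      | zero => simp
      | succ c =>
        rw [Finset.sum_range_succ', qInt, Finset.mul_sum, Finset.sum_mul, if_pos (by omega), add_zero]
        refine Finset.sum_congr rfl fun d hd => ?_
        rw [Finset.mem_range] at hd
        rw [if_neg (by omega)]
        congr 3 <;> omega
  · match c with
    | 0 => simp
    | 1 => simp
    | c + 2 =>
      rw [Finset.sum_range_succ', Finset.sum_range_succ, qInt, Finset.mul_sum, Finset.sum_mul,
        if_pos (by omega : c + 2 - 1 - (c + 2 - 1 - 0) = 0), add_zero, if_neg (by omega),
        if_pos (by omega), add_zero]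
      refine Finset.sum_congr rfl fun d hd => ?_
      rw [Finset.mem_range] at hd
      rw [if_neg (by omega), if_neg (by omega)]
      refine congrArg₂ _ (congrArg _ (congrArg _ ?_)) (congrArg _ ?_) <;> omega

theorem sum_blockWords {n N : ℕ} (hN : N ≤ n) (φ : ℕ → R) :
    ((blockWords n N).map fun w => wordWeight q t u (n - N) n w * φ (w.count 0)).sum =
      ((transfer q t u)^[N] φ) 1 := by
  induction N generalizing φ with
  | zero => simp [blockWords, wordWeight]
  | succ N ih =>
    have hflat : ∀ {α β : Type} (l : List α) (f : α → List β) (g : β → R),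
        ((l.flatMap f).map g).sum = (l.map fun a => ((f a).map g).sum).sum := by
      intro α β l f g
      induction l with
      | nil => simp
      | cons a l ihl => simp [ihl]
    rw [Function.iterate_succ_apply, ← ih (by omega), blockWords, hflat, hflat]
    refine congrArg List.sum (List.map_congr_left fun w hw => ?_)
    rw [mem_blockWords (by omega)] at hw
    have : ((zeroMarks w).map fun p => ((expand (n - N) p).map fun z =>
        wordWeight q t u (n - (N + 1)) n z * φ (z.count 0)).sum) =
        (zeroMarks w).map fun p => wordWeight q t u (n - N) n w *
          markWeight q t u φ (p.1.count 0) (p.2.count 0) := by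
      refine List.map_congr_left fun p hp => ?_
      rw [← sum_expand q t u (by omega) (by omega) hw hp, Nat.sub_sub]
    rw [this, List.sum_map_mul_left, sum_zeroMarks w (markWeight q t u φ), sum_markWeight]

theorem prod_qInt_mul_transfer (m h : ℕ) :
    (∏ i ∈ Finset.range (h + 1), qInt q (i + 1)) *
      ((transfer q t u)^[m] fun c => if c = 2 then 1 else 0) (h + 2) = motzkin q t u m h := by
  induction m generalizing h with
  | zero =>
    rw [motzkin, Function.iterate_zero, id]
    rcases eq_or_ne h 0 with rfl | hh
    · simp
    · simp [hh]
  | succ m ih =>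
    rw [Function.iterate_succ_apply', transfer]
    have h1 := ih (h + 1)
    have h0 := ih h
    rw [Finset.prod_range_succ] at h1
    cases h with
    | zero =>
      rw [motzkin, ← h1, ← h0]
      simp
    | succ h =>
      have h2 := ih h
      rw [motzkin, ← h1, ← h0, ← h2, Finset.prod_range_succ _ (h + 1)]
      simp only [show h + 1 + 2 - 1 = h + 2 by omega, show h + 1 + 2 - 2 = h + 1 by omega]
      ring

/-- The block words with exactly two zeros are the words of permutations. -/
theorem sum_blockWords_eq_motzkin (m : ℕ) :
    ((blockWords (m + 1) (m + 1)).map fun w =>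
      wordWeight q t u 0 (m + 1) w * if w.count 0 = 2 then 1 else 0).sum = motzkin q t u m 0 := by
  have := sum_blockWords q t u (le_refl (m + 1)) fun c => if c = 2 then 1 else 0
  rw [Nat.sub_self] at this
  rw [this, Function.iterate_succ_apply', transfer, ← prod_qInt_mul_transfer]
  simp

end Transfer

/-! ### Permutations as block words -/

/-- The word `0 σ(1) ⋯ σ(n) 0`. -/
def permWord {n : ℕ} (σ : Equiv.Perm (Fin n)) : List ℕ :=
  0 :: (List.ofFn (fun i => (σ i : ℕ) + 1) ++ [0])

theorem isSide_zero_cons_append {l : List ℕ} (hl : l ≠ []) (h : ∀ x ∈ l, x ≠ 0) :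
    IsSide (0 :: (l ++ [0])) := by
  have h1 : ∀ l' : List ℕ, (∀ x ∈ l', x ≠ 0) → IsSide (l' ++ [0]) := by
    intro l' h'
    induction l' with
    | nil => simp [IsSide]
    | cons a l' ih =>
      rw [List.cons_append, isSide_cons (h' a (by simp))]
      exact ih fun x hx => h' x (by simp [hx])
  refine isSide_zero_cons.2 (Or.inr ⟨?_, h1 l h⟩)
  cases l with
  | nil => exact absurd rfl hl
  | cons a l => exact h a (by simp)

theorem isBlockWord_permWord {n : ℕ} (hn : 1 ≤ n) (σ : Equiv.Perm (Fin n)) :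
    IsBlockWord 0 n (permWord σ) := by
  have hne : List.ofFn (fun i => (σ i : ℕ) + 1) ≠ [] := by
    rw [← List.length_pos_iff, List.length_ofFn]; exact hn
  have h0 : ∀ x ∈ List.ofFn (fun i => (σ i : ℕ) + 1), x ≠ 0 := by
    intro x hx
    obtain ⟨i, rfl⟩ := List.mem_ofFn.1 hx
    omega
  refine ⟨isSide_zero_cons_append hne h0, ?_, fun v hv => ?_⟩
  · have := isSide_zero_cons_append (l := (List.ofFn (fun i => (σ i : ℕ) + 1)).reverse)
      (by simpa only [ne_eq, List.reverse_eq_nil_iff] using hne) (by simp)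
    simpa [permWord] using this
  · rw [permWord, List.count_cons_of_ne hv.symm, List.count_append, List.count_cons_of_ne hv.symm,
      List.count_nil, add_zero]
    have hnd : (List.ofFn (fun i => (σ i : ℕ) + 1)).Nodup := by
      rw [List.nodup_ofFn]
      intro i j hij
      simpa [Fin.val_inj] using hij
    split_ifs with h
    · refine List.count_eq_one_of_mem hnd (List.mem_ofFn.2 ⟨σ.symm ⟨v - 1, by omega⟩, ?_⟩)
      simp; omega
    · rw [List.count_eq_zero, List.mem_ofFn]
      rintro ⟨i, rfl⟩
      have := (σ i).isLt
      omega

theorem count_zero_permWord {n : ℕ} (σ : Equiv.Perm (Fin n)) : (permWord σ).count 0 = 2 := by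
  have : (List.ofFn (fun i => (σ i : ℕ) + 1)).count 0 = 0 := by
    rw [List.count_eq_zero, List.mem_ofFn]
    rintro ⟨i, hi⟩
    omega
  simp [permWord, this]

theorem permWord_injective {n : ℕ} :
    Function.Injective (permWord : Equiv.Perm (Fin n) → List ℕ) := by
  intro σ τ h
  have h' := List.ofFn_injective (List.append_cancel_right (List.cons.inj h).2)
  refine Equiv.ext fun i => Fin.ext ?_
  simpa using congrFun h' i

theorem exists_permWord_eq {n : ℕ} {w : List ℕ} (hw : IsBlockWord 0 n w) (h2 : w.count 0 = 2) :
    ∃ σ : Equiv.Perm (Fin n), permWord σ = w := by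
  obtain ⟨l, rfl⟩ : ∃ l, w = 0 :: (l ++ [0]) := by
    have h1 := hw.isSide.1
    have h3 := hw.isSide_reverse.1
    rw [List.getLast?_reverse] at h3
    cases w with
    | nil => simp at h1
    | cons a w =>
      obtain rfl : a = 0 := by simpa using h3
      rcases List.eq_nil_or_concat w with rfl | ⟨l, b, rfl⟩
      · simp at h2
      · refine ⟨l, ?_⟩
        rw [List.concat_eq_append, ← List.cons_append, List.getLast?_concat, Option.some_inj] at h1
        rw [List.concat_eq_append, h1]
  have hcount : ∀ v, l.count v = (List.range' 1 n).count v := by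
    intro v
    rcases eq_or_ne v 0 with rfl | hv
    · have : List.count 0 (List.range' 1 n) = 0 := by
        rw [List.count_eq_zero]; simp
      rw [this]
      simpa using h2
    · have hc := hw.count_eq v hv
      rw [List.count_cons_of_ne hv.symm, List.count_append, List.count_cons_of_ne hv.symm,
        List.count_nil, add_zero] at hc
      rw [hc]
      split_ifs with h
      · exact (List.count_eq_one_of_mem List.nodup_range' (by simp; omega)).symm
      · symm
        rw [List.count_eq_zero]
        simp; omega
  have hperm : l.Perm (List.range' 1 n) := List.perm_iff_count.2 hcount
  have hlen : l.length = n := by rw [hperm.length_eq, List.length_range']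
  have hnd : l.Nodup := hperm.nodup_iff.2 List.nodup_range'
  have hmem : ∀ (i : ℕ) (hi : i < l.length), 1 ≤ l[i] ∧ l[i] ≤ n := by
    intro i hi
    have := hperm.subset (List.getElem_mem hi)
    simp at this
    omega
  let f : Fin n → Fin n := fun i =>
    ⟨l[(i : ℕ)]'(by omega) - 1, by have := hmem i (by omega); omega⟩
  have hf : Function.Injective f := by
    intro i j hij
    have h1 := hmem i (by omega)
    have h2 := hmem j (by omega)
    have h3 : l[(i : ℕ)]'(by omega) = l[(j : ℕ)]'(by omega) := by
      have := congrArg Fin.val hij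
      simp only [f] at this
      omega
    exact Fin.ext ((List.Nodup.getElem_inj_iff hnd).1 h3)
  refine ⟨Equiv.ofBijective f (Finite.injective_iff_bijective.1 hf), ?_⟩
  rw [permWord]
  congr 2
  refine List.ext_getElem (by simp [hlen]) fun i h1 h2 => ?_
  have := hmem i h2
  simp only [List.getElem_ofFn, Equiv.ofBijective_apply, f]
  omega

theorem sum_perm_eq_sum_blockWords {R : Type*} [CommRing R] {n : ℕ} (hn : 1 ≤ n) (f : List ℕ → R) :
    ∑ σ : Equiv.Perm (Fin n), f (permWord σ) =
      ((blockWords n n).map fun w => f w * if w.count 0 = 2 then 1 else 0).sum := by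
  rw [← List.sum_toFinset _ (nodup_blockWords le_rfl)]
  simp only [mul_ite, mul_one, mul_zero]
  rw [← Finset.sum_filter]
  refine Finset.sum_bij (fun σ _ => permWord σ) ?_ ?_ ?_ ?_
  · intro σ _
    rw [Finset.mem_filter, List.mem_toFinset, mem_blockWords le_rfl, Nat.sub_self]
    exact ⟨isBlockWord_permWord hn σ, count_zero_permWord σ⟩
  · exact fun _ _ _ _ h => permWord_injective h
  · intro w hw
    rw [Finset.mem_filter, List.mem_toFinset, mem_blockWords le_rfl, Nat.sub_self] at hw
    obtain ⟨σ, h⟩ := exists_permWord_eq hw.1 hw.2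
    exact ⟨σ, Finset.mem_univ _, h⟩
  · intros; rfl

theorem word_pos {n : ℕ} (σ : Equiv.Perm (Fin n)) {i : ℕ} (h1 : 1 ≤ i) (hi : i ≤ n) :
    0 < word σ i := by
  rw [word, dif_pos ⟨h1, hi⟩]; omega

theorem word_eq_zero {n : ℕ} (σ : Equiv.Perm (Fin n)) {i : ℕ} (hi : n < i) : word σ i = 0 := by
  rw [word, dif_neg (by omega)]

theorem word_inj {n : ℕ} (σ : Equiv.Perm (Fin n)) {i j : ℕ} (hi1 : 1 ≤ i) (hi : i ≤ n)
    (h : word σ j = word σ i) : j = i := by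
  have hpos := word_pos σ hi1 hi
  have hj : 1 ≤ j ∧ j ≤ n := by
    by_contra hj
    rw [word, dif_neg hj] at h
    omega
  rw [word, word, dif_pos hj, dif_pos ⟨hi1, hi⟩, Nat.add_right_cancel_iff, Fin.val_inj,
    σ.apply_eq_iff_eq, Fin.mk.injEq] at h
  omega

theorem permWord_eq_map {n : ℕ} (σ : Equiv.Perm (Fin n)) :
    permWord σ = (List.range (n + 2)).map (word σ) := by
  rw [List.range_succ, List.map_append, List.range_succ_eq_map, List.map_cons, List.map_map,
    List.map_singleton, word_zero, word_succ_self, permWord, List.cons_append]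
  congr 2
  refine List.ext_getElem (by simp) fun i h1 h2 => ?_
  have hi : i < n := by simpa using h1
  simp [word_fin_succ σ ⟨i, hi⟩]

theorem crossings_range' {n : ℕ} (σ : Equiv.Perm (Fin n)) (v a k : ℕ) (h : a + k = n + 2) :
    crossings v ((List.range' a k).map (word σ)) =
      ((Finset.Ico a (n + 2)).filter fun j => word σ j < v ∧ v < word σ (j + 1)).card := by
  induction k generalizing a with
  | zero =>
    rw [Finset.Ico_eq_empty (by omega)]
    simp [crossings]
  | succ k ih =>
    have hhead : ((List.range' (a + 1) k).map (word σ)).headD 0 = word σ (a + 1) := by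
      cases k with
      | zero => simp [word_eq_zero σ (show n < a + 1 by omega)]
      | succ k => simp [List.range'_succ]
    rw [List.range'_succ, List.map_cons, crossings, hhead, ih _ (by omega),
      ← Finset.insert_Ico_add_one_left_eq_Ico (show a < n + 2 by omega), Finset.filter_insert]
    split_ifs with hc
    · rw [Finset.card_insert_of_notMem (by simp), add_comm]
    · rw [zero_add]

theorem headD_reverse_range {n : ℕ} (σ : Equiv.Perm (Fin n)) (i : ℕ) :
    ((List.range i).map (word σ)).reverse.headD 0 = word σ (i - 1) := by
  cases i with
  | zero => simp [word_zero]
  | succ i => simp [List.range_succ]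

theorem crossings_reverse_range {n : ℕ} (σ : Equiv.Perm (Fin n)) (v i : ℕ) :
    crossings v ((List.range i).map (word σ)).reverse =
      ((Finset.range i).filter fun j => word σ j < v ∧ v < word σ (j - 1)).card := by
  induction i with
  | zero => simp [crossings]
  | succ i ih =>
    rw [List.range_succ, List.map_append, List.reverse_append, List.map_singleton,
      List.reverse_singleton, List.singleton_append, crossings, headD_reverse_range, ih,
      Finset.range_add_one, Finset.filter_insert]
    split_ifs with hc
    · rw [Finset.card_insert_of_notMem (by simp), add_comm]
    · rw [zero_add]

theorem les_eq_sum {n : ℕ} (σ : Equiv.Perm (Fin n)) :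
    les σ = ∑ i ∈ Finset.Icc 1 n,
      ((Finset.range i).filter fun j => word σ j < word σ i ∧ word σ i < word σ (j - 1)).card := by
  rw [les, ← Finset.card_sigma]
  refine Finset.card_nbij' (fun p => ⟨p.2, p.1⟩) (fun p => (p.2, p.1)) ?_ ?_ ?_ ?_
  · rintro ⟨i, j⟩ h
    simp at h ⊢
    omega
  · rintro ⟨j, i⟩ h
    simp at h ⊢
    have : 2 ≤ i := by
      by_contra hi
      have : word σ (i - 1) = 0 := by
        rw [show i - 1 = 0 by omega, word_zero]
      omega
    omega
  · intro _ _; rfl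
  · intro _ _; rfl

theorem res_eq_sum {n : ℕ} (σ : Equiv.Perm (Fin n)) :
    res σ = ∑ i ∈ Finset.Icc 1 n, ((Finset.Ico (i + 1) (n + 2)).filter
      fun j => word σ j < word σ i ∧ word σ i < word σ (j + 1)).card := by
  rw [res, ← Finset.card_sigma]
  refine Finset.card_nbij' (fun p => ⟨p.1, p.2⟩) (fun p => (p.1, p.2)) ?_ ?_ ?_ ?_
  · rintro ⟨i, j⟩ h
    simp at h ⊢
    omega
  · rintro ⟨i, j⟩ h
    simp at h ⊢
    have : j + 1 ≤ n := by
      by_contra hj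
      have := word_eq_zero σ (show n < j + 1 by omega)
      omega
    omega
  · intro _ _; rfl
  · intro _ _; rfl

section Product

variable {R : Type*} [CommRing R] (q t u : R)

theorem letterWeight_permWord {n : ℕ} (σ : Equiv.Perm (Fin n)) {i : ℕ} (h1 : 1 ≤ i) (hi : i ≤ n) :
    letterWeight q t u (word σ i) (permWord σ) =
      (if word σ (i - 1) < word σ i then if word σ (i + 1) < word σ i then 1 else u
        else if word σ (i + 1) < word σ i then 0 else t) *
      q ^ (2 * ((Finset.Ico (i + 1) (n + 2)).filter
          fun j => word σ j < word σ i ∧ word σ i < word σ (j + 1)).card +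
        ((Finset.range i).filter
          fun j => word σ j < word σ i ∧ word σ i < word σ (j - 1)).card) := by
  have hsplit : permWord σ = (List.range i).map (word σ) ++
      word σ i :: (List.range' (i + 1) (n + 1 - i)).map (word σ) := by
    rw [permWord_eq_map, ← List.map_cons, ← List.range'_succ, ← List.map_append, List.range_eq_range',
      List.range_eq_range']
    congr 1
    have := List.range'_append (s := 0) (m := i) (n := n + 1 - i + 1) (step := 1)
    rw [show 0 + 1 * i = i by omega] at this
    rw [this]
    congr 1
    omega
  have hnot : word σ i ∉ (List.range i).map (word σ) := by
    rw [List.mem_map]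
    rintro ⟨j, hj, h⟩
    have := word_inj σ h1 hi h
    rw [List.mem_range] at hj
    omega
  have hhead : ((List.range' (i + 1) (n + 1 - i)).map (word σ)).headD 0 = word σ (i + 1) := by
    rw [show n + 1 - i = n - i + 1 by omega, List.range'_succ]
    rfl
  rw [hsplit, letterWeight_append_cons q t u hnot, contextWeight, headD_reverse_range, hhead,
    crossings_reverse_range, crossings_range' σ _ _ _ (by omega)]

theorem prod_Icc_one {M : Type*} [CommMonoid M] (n : ℕ) (g : ℕ → M) :
    ∏ i ∈ Finset.Icc 1 n, g i = ∏ i : Fin n, g (i + 1) := by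
  rw [← Finset.prod_range (fun i => g (i + 1)), Finset.range_eq_Ico,
    Finset.prod_Ico_add' g 0 n 1]
  rfl

/-- The number of `1 ≤ i ≤ n` with `σ(i-1) < σ(i) < σ(i+1)`. -/
def doubleAscents {n : ℕ} (σ : Equiv.Perm (Fin n)) : ℕ :=
  ((Finset.Icc 1 n).filter
    fun i : ℕ => word σ (i - 1) < word σ i ∧ word σ i < word σ (i + 1)).card

theorem word_pred_ne {n : ℕ} (σ : Equiv.Perm (Fin n)) {i : ℕ} (h1 : 1 ≤ i) (hi : i ≤ n) :
    word σ (i - 1) ≠ word σ i := fun h => by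
  have := word_inj σ h1 hi h
  omega

theorem word_succ_ne {n : ℕ} (σ : Equiv.Perm (Fin n)) {i : ℕ} (h1 : 1 ≤ i) (hi : i ≤ n) :
    word σ (i + 1) ≠ word σ i := fun h => by
  have := word_inj σ h1 hi h
  omega

theorem wordWeight_permWord {n : ℕ} (σ : Equiv.Perm (Fin n)) :
    wordWeight q t u 0 n (permWord σ) =
      if doubleDescents σ = 0 then
        q ^ (2 * res σ + les σ) * t ^ valleys σ * u ^ doubleAscents σ else 0 := by
  have hreindex : wordWeight q t u 0 n (permWord σ) =
      ∏ i ∈ Finset.Icc 1 n, letterWeight q t u (word σ i) (permWord σ) := by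
    rw [wordWeight, ← Finset.Icc_add_one_left_eq_Ioc, zero_add, prod_Icc_one, prod_Icc_one]
    simp only [word_fin_succ]
    exact (Equiv.prod_comp σ fun i => letterWeight q t u (i + 1) (permWord σ)).symm
  rw [hreindex]
  split_ifs with hdd
  · rw [doubleDescents, Finset.card_eq_zero, Finset.filter_eq_empty_iff] at hdd
    have : ∀ i ∈ Finset.Icc 1 n, letterWeight q t u (word σ i) (permWord σ) =
        q ^ (2 * ((Finset.Ico (i + 1) (n + 2)).filter
          fun j => word σ j < word σ i ∧ word σ i < word σ (j + 1)).card +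
        ((Finset.range i).filter
          fun j => word σ j < word σ i ∧ word σ i < word σ (j - 1)).card) *
        (if word σ i < word σ (i - 1) ∧ word σ i < word σ (i + 1) then t else 1) *
        if word σ (i - 1) < word σ i ∧ word σ i < word σ (i + 1) then u else 1 := by
      intro i hi
      have hd := hdd hi
      rw [Finset.mem_Icc] at hi
      have hp := word_pred_ne σ hi.1 hi.2
      have hs := word_succ_ne σ hi.1 hi.2
      rw [letterWeight_permWord q t u σ hi.1 hi.2]
      split_ifs <;> first | omega | ring
    rw [Finset.prod_congr rfl this, Finset.prod_mul_distrib, Finset.prod_mul_distrib,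
      Finset.prod_pow_eq_pow_sum, Finset.sum_add_distrib, ← Finset.mul_sum, ← res_eq_sum,
      ← les_eq_sum, Finset.prod_ite, Finset.prod_ite]
    simp [valleys, doubleAscents]
  · obtain ⟨i, hi⟩ := Finset.card_pos.1 (Nat.pos_of_ne_zero hdd)
    rw [Finset.mem_filter] at hi
    refine Finset.prod_eq_zero hi.1 ?_
    rw [Finset.mem_Icc] at hi
    rw [letterWeight_permWord q t u σ hi.1.1 hi.1.2, if_neg (by omega), if_pos hi.2.2, zero_mul]

/-- There is one peak more than there are valleys. -/
theorem two_mul_valleys_add {n : ℕ} (hn : 1 ≤ n) (σ : Equiv.Perm (Fin n)) :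
    2 * valleys σ + doubleAscents σ + doubleDescents σ + 1 = n := by
  have hsum : ∑ i ∈ Finset.Icc 1 n, (if word σ (i - 1) < word σ i then 1 else 0) =
      ∑ i ∈ Finset.Icc 1 n, (if word σ i < word σ (i + 1) then 1 else 0) + 1 := by
    rw [sum_Icc_one, sum_Icc_one]
    obtain ⟨m, rfl⟩ : ∃ m, n = m + 1 := ⟨n - 1, by omega⟩
    simp only [Nat.add_sub_cancel]
    rw [Fin.sum_univ_eq_sum_range (fun i => if word σ i < word σ (i + 1) then 1 else 0),
      Fin.sum_univ_eq_sum_range (fun i => if word σ (i + 1) < word σ (i + 1 + 1) then 1 else 0),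
      Finset.sum_range_succ', Finset.sum_range_succ, word_succ_self, word_zero,
      if_pos (word_pos σ le_rfl (by omega)), if_neg (by omega)]
  have hpt : ∑ i ∈ Finset.Icc 1 n,
        (2 * (if word σ i < word σ (i - 1) ∧ word σ i < word σ (i + 1) then 1 else 0) +
        (if word σ (i - 1) < word σ i ∧ word σ i < word σ (i + 1) then 1 else 0) +
        (if word σ i < word σ (i - 1) ∧ word σ (i + 1) < word σ i then 1 else 0) +
        (if word σ (i - 1) < word σ i then 1 else 0)) =
      ∑ i ∈ Finset.Icc 1 n, (1 + if word σ i < word σ (i + 1) then 1 else 0) := by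
    refine Finset.sum_congr rfl fun i hi => ?_
    rw [Finset.mem_Icc] at hi
    have hp := word_pred_ne σ hi.1 hi.2
    have hs := word_succ_ne σ hi.1 hi.2
    split_ifs <;> omega
  simp only [Finset.sum_add_distrib, ← Finset.mul_sum, ← Finset.card_filter, Finset.sum_const,
    Nat.card_Icc] at hpt hsum
  simp only [valleys, doubleAscents, doubleDescents]
  simp at hpt
  omega

/-- The generating polynomial of the permutations without double descents, with `u` marking the
double ascents. -/
theorem sum_valleys_eq_motzkin (m : ℕ) :
    ∑ σ : Equiv.Perm (Fin (m + 1)) with doubleDescents σ = 0,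
      q ^ (2 * res σ + les σ) * t ^ valleys σ * u ^ (m - 2 * valleys σ) = motzkin q t u m 0 := by
  rw [← sum_blockWords_eq_motzkin, ← sum_perm_eq_sum_blockWords (by omega), Finset.sum_filter]
  refine Finset.sum_congr rfl fun σ _ => ?_
  rw [wordWeight_permWord]
  split_ifs with h
  · have := two_mul_valleys_add (by omega) σ
    rw [show doubleAscents σ = m - 2 * valleys σ by omega]
  · rfl

end Product

/-! ### The expansion and the divisibility -/

theorem SDiv_eq_sum (n : ℕ) : SDiv n = ∑ σ : Equiv.Perm (Fin n), invExcWeight σ := by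
  rw [SDiv, S, eval₂_finsetSum]
  refine Finset.sum_congr rfl fun σ _ => ?_
  rw [eval₂_mul, eval₂_C, eval₂_X_pow, RingHom.comp_apply, mul_pow, ← map_pow, ← mul_assoc,
    ← map_mul, invExcWeight]
  congr 2
  rw [map_pow, toLaurent_X, LaurentPolynomial.T_pow, LaurentPolynomial.T_pow,
    ← LaurentPolynomial.T_add]
  congr 1
  ring

theorem SDiv_eq_sum_valleys (n : ℕ) (hn : 1 ≤ n) :
    SDiv n = ∑ k ∈ Finset.range ((n - 1) / 2 + 1),
      C (toLaurent (∑ σ ∈ permsWithValleys n k, (X : ℤ[X]) ^ (2 * res σ + les σ))) * X ^ k *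
        (1 + X) ^ (n - 1 - 2 * k) := by
  obtain ⟨m, rfl⟩ : ∃ m, n = m + 1 := ⟨n - 1, by omega⟩
  rw [SDiv_eq_sum, sum_invExcWeight_eq_motzkin, ← sum_valleys_eq_motzkin, Nat.add_sub_cancel,
    ← Finset.sum_fiberwise_of_maps_to (g := valleys) (t := Finset.range (m / 2 + 1))]
  · refine Finset.sum_congr rfl fun k _ => ?_
    have hset : (Finset.univ.filter fun σ : Equiv.Perm (Fin (m + 1)) =>
        doubleDescents σ = 0).filter (fun σ => valleys σ = k) = permsWithValleys (m + 1) k := by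
      ext σ; simp [permsWithValleys, and_comm]
    rw [hset, map_sum, map_sum, Finset.sum_mul, Finset.sum_mul]
    refine Finset.sum_congr rfl fun σ hσ => ?_
    have hk : valleys σ = k := by
      simp only [permsWithValleys, Finset.mem_filter] at hσ
      exact hσ.2.1
    rw [hk, qVar_pow, map_pow, toLaurent_X, LaurentPolynomial.T_pow, mul_one]
  · intro σ _
    have := two_mul_valleys_add (by omega) σ
    rw [Finset.mem_range]
    omega

/-- Of two consecutive `q`-integers one has even index, so that their product is divisible by
`1 + q`. -/
theorem dvd_qInt_mul_qInt {R : Type*} [CommRing R] (q : R) (h : ℕ) :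
    q * (1 + q) ∣ qInt q (h + 1) * qInt q (h + 2) := by
  have hfac : ∀ k, qInt q (k + 1) = q ^ k * ∑ i ∈ Finset.range (k + 1), q ^ i := by
    intro k
    rw [qInt, Finset.mul_sum]
    refine Finset.sum_congr rfl fun i _ => ?_
    rw [Nat.add_sub_cancel, pow_add]
  have heven : ∀ k, (1 + q) ∣ ∑ i ∈ Finset.range (2 * k), q ^ i := by
    intro k
    induction k with
    | zero => simp
    | succ k ih =>
      rw [show 2 * (k + 1) = 2 * k + 1 + 1 by ring, Finset.sum_range_succ, Finset.sum_range_succ,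
        add_assoc]
      refine dvd_add ih ⟨q ^ (2 * k), by ring⟩
  rw [hfac h, hfac (h + 1), show h + 1 + 1 = h + 2 by rfl]
  have hdvd : (1 + q) ∣ (∑ i ∈ Finset.range (h + 1), q ^ i) * ∑ i ∈ Finset.range (h + 2), q ^ i := by
    rcases Nat.even_or_odd' h with ⟨k, rfl | rfl⟩
    · exact Dvd.dvd.mul_left (heven (k + 1)) _
    · exact Dvd.dvd.mul_right (heven (k + 1)) _
  obtain ⟨x, hx⟩ := hdvd
  exact ⟨q ^ (2 * h) * x, by linear_combination q ^ (2 * h + 1) * hx⟩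

/-- Each fall of a Motzkin path contributes a factor `t` together with a multiple of `q (1 + q)`. -/
theorem pow_dvd_coeff_motzkin (m h k : ℕ) :
    ((X : ℤ[X]) * (1 + X)) ^ k ∣ (motzkin (C X) X 1 m h : ℤ[X][X]).coeff k := by
  have hC : ∀ h, qInt (C X : ℤ[X][X]) h = C (qInt X h) := by
    intro h
    simp [qInt]
  induction m generalizing h k with
  | zero =>
    rw [motzkin]
    split_ifs
    · rw [coeff_one]
      split_ifs with hk
      · subst hk; simp
      · simp
    · simp
  | succ m ih =>
    cases h with
    | zero =>
      rw [motzkin, one_mul, hC, coeff_add, coeff_C_mul]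
      exact dvd_add (ih _ _) (Dvd.dvd.mul_left (ih _ _) _)
    | succ h =>
      rw [motzkin, one_mul, hC, hC, coeff_add, coeff_add, coeff_C_mul]
      refine dvd_add (dvd_add (ih _ _) (Dvd.dvd.mul_left (ih _ _) _)) ?_
      rw [mul_assoc X, ← C_mul, mul_assoc]
      cases k with
      | zero => simp
      | succ k =>
        rw [coeff_X_mul, coeff_C_mul, pow_succ']
        exact mul_dvd_mul (dvd_qInt_mul_qInt X h) (ih _ _)

theorem pow_dvd_sum_permsWithValleys (n k : ℕ) (hn : 1 ≤ n) :
    (X : ℤ[X]) ^ k * (1 + X) ^ k ∣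
      ∑ σ ∈ permsWithValleys n k, (X : ℤ[X]) ^ (2 * res σ + les σ) := by
  obtain ⟨m, rfl⟩ : ∃ m, n = m + 1 := ⟨n - 1, by omega⟩
  have := pow_dvd_coeff_motzkin m 0 k
  rw [← sum_valleys_eq_motzkin, finsetSum_coeff, mul_pow] at this
  convert this using 1
  rw [show permsWithValleys (m + 1) k = (Finset.univ.filter fun σ : Equiv.Perm (Fin (m + 1)) =>
    doubleDescents σ = 0).filter (fun σ => k = valleys σ) by
      ext σ; simp [permsWithValleys, and_comm, eq_comm], Finset.sum_filter]
  refine Finset.sum_congr rfl fun σ _ => ?_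
  rw [one_pow, mul_one, ← C_pow, coeff_C_mul, coeff_X_pow, mul_ite, mul_one, mul_zero]

end InvExc

theorem theorem5 (n : ℕ) (hn : 1 ≤ n) :
    ∃ γ : ℕ → ℤ[X],
      (InvExc.SDiv n = ∑ σ : Equiv.Perm (Fin n),
        C (LaurentPolynomial.T ((InvExc.inv σ : ℤ) - (InvExc.exc σ : ℤ))) * X ^ InvExc.exc σ) ∧
      (InvExc.SDiv n = ∑ k ∈ Finset.range ((n - 1) / 2 + 1),
        C (toLaurent (γ k)) * X ^ k * (1 + X) ^ (n - 1 - 2 * k)) ∧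
      ∀ k : ℕ, k ≤ (n - 1) / 2 →
        (∀ m : ℕ, 0 ≤ (γ k).coeff m) ∧
        γ k = MvPolynomial.aeval ![(X : ℤ[X]) ^ 2, (X : ℤ[X])] (InvExc.a n k) ∧
        γ k = ∑ σ ∈ InvExc.permsWithValleys n k,
          (X : ℤ[X]) ^ (2 * InvExc.res σ + InvExc.les σ) ∧
        (X : ℤ[X]) ^ k * (1 + X) ^ k ∣ γ k := by
  refine ⟨fun k => ∑ σ ∈ InvExc.permsWithValleys n k,
    (X : ℤ[X]) ^ (2 * InvExc.res σ + InvExc.les σ), InvExc.SDiv_eq_sum n,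
    InvExc.SDiv_eq_sum_valleys n hn, fun k _ => ⟨fun m => ?_, ?_, rfl,
      InvExc.pow_dvd_sum_permsWithValleys n k hn⟩⟩
  · rw [finsetSum_coeff]
    refine Finset.sum_nonneg fun σ _ => ?_
    rw [coeff_X_pow]
    split_ifs <;> simp
  · rw [InvExc.a, map_sum]
    refine Finset.sum_congr rfl fun σ _ => ?_
    simp [pow_add, pow_mul]
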